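/- Let $G$ be a directed acyclic network with $d$ links and with distinct source and destination, and let $\mathcal{A}\subseteq\{0,1\}^d$ be the set of incidence vectors of its source–destination paths. Let $d_0$ be the rank of $\mathcal{A}$ (the dimension of its linear span; it may be smaller than $d$), and let $\mathcal{B}=(\boldsymbol b_1,\dots,\boldsymbol b_{d_0})$ be an $S$-approximate barycentric spanner of $\mathcal{A}$, i.e. $\boldsymbol b_i\in\mathcal{A}$ for all $i$ and every $\boldsymbol a\in\mathcal{A}$ can be written as $\boldsymbol a=\sum_{i=1}^{d_0}\nu_{\boldsymbol a,i}\boldsymbol b_i$ with $|\nu_{\boldsymbol a,i}|\le S$ for all $i$. Let $\boldsymbol\mu\in\mathbb{R}^d$ be the mean link delay vector. In round $t$ a path $\boldsymbol a_{I_t}$ is chosen on the basis of the past choices and observations, and the end-to-end delay $L_t=\langle\boldsymbol a_{I_t},\boldsymbol\mu\rangle+\eta_t$ is observed. The noise is conditionally $R$-sub-Gaussian with $R>0$: given $H_{t-1}=(\boldsymbol a_{I_1},\dots,\boldsymbol a_{I_{t-1}},\eta_1,\dots,\eta_{t-1})$ it satisfies $\mathbb{E}[\eta_t\mid H_{t-1}]=0$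 and $\mathbb{E}[e^{\alpha\eta_t}\mid H_{t-1}]\le e^{\alpha^2R^2/2}$ for all $\alpha\in\mathbb{R}$. Let $m$ be a positive integer and suppose that the first $md_0$ rounds form $m$ epochs of exploration, each consisting of $d_0$ rounds in which every path of $\mathcal{B}$ is chosen exactly once. Let $\mathcal{D}_m\in\mathbb{R}^{md_0\times d}$ be the matrix with rows $\boldsymbol a_{I_1}^\top,\dots,\boldsymbol a_{I_{md_0}}^\top$, let $\boldsymbol r_m=(L_1,\dots,L_{md_0})^\top$, and let $$\hat{\boldsymbol\mu}_m=\left(\mathcal{D}_m^\top\mathcal{D}_m\right)^{\dagger}\mathcal{D}_m^\top\boldsymbol r_m,$$ where $\dagger$ denotes the Moore–Penrose pseudo-inverse. Then for every $\delta\in(0,1]$ $$\Pr\left(\exists\,\boldsymbol a\in\mathcal{A}:\ \left|\langle\boldsymbol a,\boldsymbol\mu\rangle-\langle\boldsymbol a,\hat{\boldsymbol\mu}_m\rangle\right|\ge SR\sqrt{\frac{32\ln(6)\,d_0^2+32\,d_0\ln\delta^{-1}}{m}}\right)\le\delta.$$ -/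

import Mathlib

open MeasureTheory
open scoped Matrix

/-! ### Networks and their paths -/

/-- `IsWalk tail head v l w`: the list `l` of links is a directed walk from `v` to `w`, where link
`e` goes from `tail e` to `head e`. -/
inductive IsWalk {V : Type*} {d : ℕ} (tail head : Fin d → V) : V → List (Fin d) → V → Prop
  | nil (v : V) : IsWalk tail head v [] v
  | cons (e : Fin d) (l : List (Fin d)) (w : V) (h : IsWalk tail head (head e) l w) :
      IsWalk tail head (tail e) (e :: l) w

/-- A directed acyclic network with node set `V` and `d` links (parallel links are allowed), with
a source and a destination. -/
structure Network (V : Type*) (d : ℕ) where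
  /-- the node where a link starts -/
  tail : Fin d → V
  /-- the node where a link ends -/
  head : Fin d → V
  /-- the source node -/
  source : V
  /-- the destination node -/
  dest : V
  /-- the source differs from the destination -/
  source_ne_dest : source ≠ dest
  /-- there is no directed cycle: every closed walk is empty -/
  acyclic : ∀ (v : V) (l : List (Fin d)), IsWalk tail head v l v → l = []

namespace Network

variable {V : Type*} {d : ℕ}

/-- The `0/1` vector of a set of links given as a list: coordinate `j` is `1` exactly when link
`j` is traversed. -/
def incidence (l : List (Fin d)) : Fin d → ℝ :=
  fun j => if j ∈ l then 1 else 0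

/-- The set of all source-destination paths, as `0/1` vectors. -/
def pathSet (N : Network V d) : Set (Fin d → ℝ) :=
  {x | ∃ l : List (Fin d), IsWalk N.tail N.head N.source l N.dest ∧ x = incidence l}

/-- The rank of the path set, i.e. the dimension of its linear span. -/
noncomputable def rank (N : Network V d) : ℕ :=
  Module.finrank ℝ (Submodule.span ℝ N.pathSet)

end Network

/-- `b 0, …, b (n - 1)` is an `S`-approximate barycentric spanner of the set `W`: these vectors
belong to `W`, their number is the dimension of the span of `W`, and every element of `W` is a
linear combination of them with coefficients in `[-S, S]`. -/
structure IsApproxBarycentricSpanner {d n : ℕ} (W : Set (Fin d → ℝ)) (S : ℝ)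
    (b : Fin n → Fin d → ℝ) : Prop where
  mem : ∀ i, b i ∈ W
  card_eq : n = Module.finrank ℝ (Submodule.span ℝ W)
  exists_coeff : ∀ x ∈ W, ∃ ν : Fin n → ℝ, (∀ i, |ν i| ≤ S) ∧ x = ∑ i, ν i • b i

/-! ### The Moore-Penrose pseudo-inverse of a real matrix -/

/-- The four Penrose equations. -/
structure IsMoorePenrose {p q : ℕ} (A : Matrix (Fin p) (Fin q) ℝ)
    (X : Matrix (Fin q) (Fin p) ℝ) : Prop where
  mul_mul_self : A * X * A = A
  mul_mul_inv : X * A * X = X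
  symm_left : (A * X)ᵀ = A * X
  symm_right : (X * A)ᵀ = X * A

theorem exists_isMoorePenrose_of_isSymm {p : ℕ} (A : Matrix (Fin p) (Fin p) ℝ) (hA : Aᵀ = A) :
    ∃ X, IsMoorePenrose A X ∧ Xᵀ = X := by
  have hH : A.IsHermitian := by
    rw [Matrix.IsHermitian, Matrix.conjTranspose_eq_transpose_of_trivial, hA]
  set f := Unitary.conjStarAlgAut ℝ (Matrix (Fin p) (Fin p) ℝ) hH.eigenvectorUnitary
  set D : Matrix (Fin p) (Fin p) ℝ := Matrix.diagonal hH.eigenvalues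
  set E : Matrix (Fin p) (Fin p) ℝ := Matrix.diagonal (fun i => (hH.eigenvalues i)⁻¹)
  have hAD : A = f D := hH.spectral_theorem
  have hT : ∀ v : Fin p → ℝ, (f (Matrix.diagonal v))ᵀ = f (Matrix.diagonal v) := by
    intro v
    rw [← Matrix.conjTranspose_eq_transpose_of_trivial, ← Matrix.star_eq_conjTranspose, ← map_star,
      Matrix.star_eq_conjTranspose, Matrix.diagonal_conjTranspose, star_trivial]
  refine ⟨f E, ⟨?_, ?_, ?_, ?_⟩, hT _⟩
  · rw [hAD, ← map_mul, ← map_mul]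
    congr 1
    simp only [D, E, Matrix.diagonal_mul_diagonal]
    congr 1
    ext i
    exact mul_inv_mul_cancel _
  · rw [hAD, ← map_mul, ← map_mul]
    congr 1
    simp only [D, E, Matrix.diagonal_mul_diagonal]
    congr 1
    ext i
    by_cases h : hH.eigenvalues i = 0 <;> simp [h]
  · rw [hAD, ← map_mul, Matrix.diagonal_mul_diagonal]
    exact hT _
  · rw [hAD, ← map_mul, Matrix.diagonal_mul_diagonal]
    exact hT _

theorem exists_isMoorePenrose {p q : ℕ} (A : Matrix (Fin p) (Fin q) ℝ) :
    ∃ X, IsMoorePenrose A X := by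
  obtain ⟨G, ⟨h1, h2, h3, h4⟩, hG⟩ := exists_isMoorePenrose_of_isSymm (Aᵀ * A)
    (by rw [Matrix.transpose_mul, Matrix.transpose_transpose])
  have key : A * (G * (Aᵀ * A) - 1) = 0 := by
    rw [← Matrix.conjTranspose_mul_self_mul_eq_zero,
      Matrix.conjTranspose_eq_transpose_of_trivial, Matrix.mul_sub, ← Matrix.mul_assoc, h1,
      Matrix.mul_one, sub_self]
  refine ⟨G * Aᵀ, ⟨?_, ?_, ?_, ?_⟩⟩
  · rw [Matrix.mul_sub, Matrix.mul_one, sub_eq_zero] at key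
    simpa [Matrix.mul_assoc] using key
  · calc G * Aᵀ * A * (G * Aᵀ) = G * (Aᵀ * A) * G * Aᵀ := by simp only [Matrix.mul_assoc]
      _ = G * Aᵀ := by rw [h2]
  · rw [Matrix.transpose_mul, Matrix.transpose_mul, hG, Matrix.transpose_transpose,
      Matrix.mul_assoc]
  · rw [Matrix.mul_assoc, h4]

/-- The Penrose equations have at most one solution. -/
theorem IsMoorePenrose.unique {p q : ℕ} {A : Matrix (Fin p) (Fin q) ℝ}
    {X Y : Matrix (Fin q) (Fin p) ℝ} (hX : IsMoorePenrose A X) (hY : IsMoorePenrose A Y) :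
    X = Y := by
  have e1 : A * X = A * Y := by
    calc A * X = (A * X)ᵀ := hX.symm_left.symm
      _ = ((A * Y) * (A * X))ᵀ := by rw [← Matrix.mul_assoc, hY.mul_mul_self]
      _ = A * X * (A * Y) := by rw [Matrix.transpose_mul, hX.symm_left, hY.symm_left]
      _ = A * Y := by rw [← Matrix.mul_assoc, hX.mul_mul_self]
  have e2 : X * A = Y * A := by
    calc X * A = (X * A)ᵀ := hX.symm_right.symm
      _ = ((X * A) * (Y * A))ᵀ := by
        rw [Matrix.mul_assoc X, ← Matrix.mul_assoc A, hY.mul_mul_self]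
      _ = Y * A * (X * A) := by rw [Matrix.transpose_mul, hX.symm_right, hY.symm_right]
      _ = Y * A := by rw [Matrix.mul_assoc Y, ← Matrix.mul_assoc A, hX.mul_mul_self]
  calc X = X * A * X := hX.mul_mul_inv.symm
    _ = Y * (A * X) := by rw [e2, Matrix.mul_assoc]
    _ = Y := by rw [e1, ← Matrix.mul_assoc, hY.mul_mul_inv]

/-- The Moore-Penrose pseudo-inverse: the unique solution of the Penrose equations. -/
noncomputable def moorePenrose {p q : ℕ} (A : Matrix (Fin p) (Fin q) ℝ) :
    Matrix (Fin q) (Fin p) ℝ :=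
  (exists_isMoorePenrose A).choose

theorem isMoorePenrose_moorePenrose {p q : ℕ} (A : Matrix (Fin p) (Fin q) ℝ) :
    IsMoorePenrose A (moorePenrose A) :=
  (exists_isMoorePenrose A).choose_spec

/-! ### Rounds, noise and exploration -/

/-- The information available before round `t`: the `σ`-algebra generated by the paths `a s` chosen
and the noise terms `η s` realised in the rounds `s < t`. -/
abbrev history {Ω : Type*} {d T : ℕ} (a : Fin T → Ω → Fin d → ℝ) (η : Fin T → Ω → ℝ) (t : Fin T) :
    MeasurableSpace Ω :=
  ⨆ s : Fin T, ⨆ _ : s < t,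
    (MeasurableSpace.comap (a s) inferInstance ⊔ MeasurableSpace.comap (η s) inferInstance)

/-- The noise terms are conditionally `R`-sub-Gaussian given the history: conditional mean zero and
`𝔼[exp (α η_t) | history] ≤ exp (α² R² / 2)` for all real `α`. -/
structure IsCondSubGaussian {Ω : Type*} [MeasurableSpace Ω] (P : Measure Ω) {d T : ℕ}
    (R : ℝ) (a : Fin T → Ω → Fin d → ℝ) (η : Fin T → Ω → ℝ) : Prop where
  measurable : ∀ t, Measurable (η t)
  integrable_exp : ∀ t (α : ℝ), Integrable (fun ω => Real.exp (α * η t ω)) P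
  condExp_eq_zero : ∀ t, P[η t | history a η t] =ᵐ[P] 0
  condExp_exp_le : ∀ t (α : ℝ), ∀ᵐ ω ∂P,
    (P[fun ω' => Real.exp (α * η t ω') | history a η t]) ω ≤ Real.exp (α ^ 2 * R ^ 2 / 2)

/-- `m` epochs of exploration of the paths `b 0, …, b (n - 1)`. The rounds are `0, …, m * n - 1`;
round `finProdFinEquiv (k, j) = j + n * k` is the `j`-th round of epoch `k`. The path of each round
is chosen on the basis of the history, and each epoch chooses every `b i` exactly once. -/
structure IsExploration {Ω : Type*} {d n m : ℕ} (b : Fin n → Fin d → ℝ)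
    (a : Fin (m * n) → Ω → Fin d → ℝ) (η : Fin (m * n) → Ω → ℝ) : Prop where
  predictable : ∀ t, Measurable[history a η t] (a t)
  epoch : ∀ (ω : Ω) (k : Fin m), ∃ σ : Equiv.Perm (Fin n),
    ∀ j : Fin n, a (finProdFinEquiv (k, j)) ω = b (σ j)

/-! ### The least squares estimator -/

/-- The design matrix, whose rows are the chosen paths. -/
def designMatrix {Ω : Type*} {d T : ℕ} (a : Fin T → Ω → Fin d → ℝ) (ω : Ω) :
    Matrix (Fin T) (Fin d) ℝ :=
  Matrix.of fun t => a t ω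

/-- The observed end-to-end delays `⟨a_t, μ⟩ + η_t`. -/
def response {Ω : Type*} {d T : ℕ} (μ : Fin d → ℝ) (a : Fin T → Ω → Fin d → ℝ)
    (η : Fin T → Ω → ℝ) (ω : Ω) : Fin T → ℝ :=
  fun t => a t ω ⬝ᵥ μ + η t ω

/-- The ordinary least squares estimator `(Dᵀ D)† Dᵀ r`. -/
noncomputable def olsEstimator {Ω : Type*} {d T : ℕ} (μ : Fin d → ℝ) (a : Fin T → Ω → Fin d → ℝ)
    (η : Fin T → Ω → ℝ) (ω : Ω) : Fin d → ℝ :=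
  moorePenrose ((designMatrix a ω)ᵀ * designMatrix a ω) *ᵥ
    ((designMatrix a ω)ᵀ *ᵥ response μ a η ω)

/-! ### The normal equations -/

/-! The normal equations say that the residuals, weighted by the chosen paths, sum to zero. Every
chosen path is some `b i`, and the `b i` are linearly independent, so this splits by index: `m`
times the error along `b i` is the noise sum `Z i` of the `m` rounds that play `b i`
(`mul_dotProduct_olsEstimator_sub`). Expanding a path in the spanner bounds `m` times its error by
`S * ∑ i, |Z i|`, uniformly over paths.

That sum of absolute values is the largest of the `2 ^ d₀` signed sums of the noise. For a fixed
sign pattern the sign in a round depends only on the path chosen there, hence is predictable, and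
the signed sum is sub-Gaussian with variance proxy `R ^ 2 * m * d₀`
(`IsCondSubGaussian.mgf_signed_sum_le`). A Chernoff bound and a union bound over sign patterns
finish the proof. -/

theorem IsMoorePenrose.gram_mul_mul_transpose {p q : ℕ} {D : Matrix (Fin p) (Fin q) ℝ}
    {X : Matrix (Fin q) (Fin q) ℝ} (hX : IsMoorePenrose (Dᵀ * D) X) :
    Dᵀ * D * X * Dᵀ = Dᵀ := by
  have hT : Xᵀ * (Dᵀ * D) = Dᵀ * D * X := by
    rw [← hX.symm_left]; simp only [Matrix.transpose_mul, Matrix.transpose_transpose]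
  -- Over the reals `Dᵀ * D * C = 0` forces `D * C = 0`, so one factor `Dᵀ` can be cancelled.
  have key : D * (Xᵀ * (Dᵀ * D) - 1) = 0 := by
    rw [← Matrix.conjTranspose_mul_self_mul_eq_zero,
      Matrix.conjTranspose_eq_transpose_of_trivial, hT, Matrix.mul_sub, Matrix.mul_one]
    have h := congrArg Matrix.transpose hX.mul_mul_self
    rw [Matrix.transpose_mul, hX.symm_left, Matrix.transpose_mul,
      Matrix.transpose_transpose] at h
    rw [h, sub_self]
  rw [hT, Matrix.mul_sub, Matrix.mul_one, sub_eq_zero] at key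
  have h := congrArg Matrix.transpose key
  rwa [Matrix.transpose_mul, hX.symm_left] at h

theorem sum_residual_smul_eq_zero {Ω : Type*} {d T : ℕ} (μ : Fin d → ℝ)
    (a : Fin T → Ω → Fin d → ℝ) (η : Fin T → Ω → ℝ) (ω : Ω) :
    ∑ t, (a t ω ⬝ᵥ (olsEstimator μ a η ω - μ) - η t ω) • a t ω = 0 := by
  have h : (designMatrix a ω)ᵀ *ᵥ (designMatrix a ω *ᵥ olsEstimator μ a η ω) =
      (designMatrix a ω)ᵀ *ᵥ response μ a η ω := by
    simp only [olsEstimator, Matrix.mulVec_mulVec]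
    rw [← Matrix.mul_assoc, ← Matrix.mul_assoc,
      (isMoorePenrose_moorePenrose _).gram_mul_mul_transpose]
  ext j
  have hj := congrFun h j
  rw [← sub_eq_zero] at hj
  simp only [Matrix.mulVec, dotProduct, Matrix.transpose_apply, designMatrix, Matrix.of_apply,
    response] at hj
  rw [← Finset.sum_sub_distrib] at hj
  simp only [Finset.sum_apply, Pi.smul_apply, smul_eq_mul, Pi.zero_apply, dotProduct_sub]
  rw [← hj]
  refine Finset.sum_congr rfl fun t _ => ?_
  simp only [dotProduct]
  ring

/-- The Gram matrix may be singular, but errors along the `b i` are still determined: they are the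
coefficients of a vanishing combination of independent vectors. -/
theorem mul_dotProduct_olsEstimator_sub {Ω : Type*} {d n T : ℕ} {m : ℝ} {b : Fin n → Fin d → ℝ}
    (hb : LinearIndependent ℝ b) (μ : Fin d → ℝ) (a : Fin T → Ω → Fin d → ℝ)
    (η : Fin T → Ω → ℝ) (ω : Ω) (idx : Fin T → Fin n) (hidx : ∀ t, a t ω = b (idx t))
    (hcount : ∀ f : Fin n → Fin d → ℝ, ∑ t, f (idx t) = m • ∑ i, f i) (i : Fin n) :
    m * (b i ⬝ᵥ (olsEstimator μ a η ω - μ)) = ∑ t with idx t = i, η t ω := by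
  have h := sum_residual_smul_eq_zero μ a η ω
  set v := olsEstimator μ a η ω - μ
  simp only [hidx, sub_smul, Finset.sum_sub_distrib] at h
  rw [hcount (fun i => (b i ⬝ᵥ v) • b i),
    ← Finset.sum_fiberwise Finset.univ idx (fun t => η t ω • b (idx t)), Finset.smul_sum,
    ← Finset.sum_sub_distrib] at h
  have h' : ∑ i, (m * (b i ⬝ᵥ v) - ∑ t with idx t = i, η t ω) • b i = 0 := by
    rw [← h]
    refine Finset.sum_congr rfl fun i _ => ?_
    rw [sub_smul, mul_smul, Finset.sum_smul]
    congr 1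
    refine Finset.sum_congr rfl fun t ht => ?_
    rw [(Finset.mem_filter.1 ht).2]
  exact sub_eq_zero.1 (Fintype.linearIndependent_iff.1 hb _ h' i)

/-! ### Spanners and paths -/

theorem IsApproxBarycentricSpanner.linearIndependent {d n : ℕ} {W : Set (Fin d → ℝ)} {S : ℝ}
    {b : Fin n → Fin d → ℝ} (hb : IsApproxBarycentricSpanner W S b) : LinearIndependent ℝ b := by
  have hspan : Submodule.span ℝ (Set.range b) = Submodule.span ℝ W := by
    refine le_antisymm (Submodule.span_mono ?_) (Submodule.span_le.2 fun x hx => ?_)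
    · rintro _ ⟨i, rfl⟩
      exact hb.mem i
    · obtain ⟨ν, -, rfl⟩ := hb.exists_coeff x hx
      exact Submodule.sum_mem _ fun i _ =>
        Submodule.smul_mem _ _ (Submodule.subset_span ⟨i, rfl⟩)
  rw [linearIndependent_iff_card_eq_finrank_span, Set.finrank, hspan, Fintype.card_fin]
  exact hb.card_eq

theorem Network.ne_zero_of_mem_pathSet {V : Type*} {d : ℕ} (N : Network V d) {x : Fin d → ℝ}
    (hx : x ∈ N.pathSet) : x ≠ 0 := by
  obtain ⟨l, hl, rfl⟩ := hx
  intro h0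
  have hnil : l = [] := List.eq_nil_iff_forall_not_mem.2 fun e he => by
    have := congrFun h0 e
    simp [incidence, he] at this
  subst hnil
  generalize hs : N.source = s at hl
  generalize ht : N.dest = t at hl
  cases hl
  exact N.source_ne_dest (hs.trans ht.symm)

/-! ### Exploration -/

theorem IsExploration.exists_index {Ω : Type*} {d n m : ℕ} {b : Fin n → Fin d → ℝ}
    {a : Fin (m * n) → Ω → Fin d → ℝ} {η : Fin (m * n) → Ω → ℝ} (ha : IsExploration b a η)
    (ω : Ω) : ∃ idx : Fin (m * n) → Fin n, (∀ t, a t ω = b (idx t)) ∧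
      ∀ f : Fin n → Fin d → ℝ, ∑ t, f (idx t) = (m : ℝ) • ∑ i, f i := by
  choose σ hσ using ha.epoch ω
  refine ⟨fun t => σ (finProdFinEquiv.symm t).1 (finProdFinEquiv.symm t).2, fun t => ?_,
    fun f => ?_⟩
  · rw [← hσ, Prod.mk.eta, Equiv.apply_symm_apply]
  · rw [← finProdFinEquiv.sum_comp, Fintype.sum_prod_type]
    simp only [Equiv.symm_apply_apply]
    simp only [fun k => Equiv.sum_comp (σ k) f]
    rw [Finset.sum_const, Finset.card_univ, Fintype.card_fin, Nat.cast_smul_eq_nsmul]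

/-- Measurability of the paths is not assumed; it follows by strong induction, since each path is
measurable for an earlier history. -/
theorem IsExploration.history_le {Ω : Type*} [mΩ : MeasurableSpace Ω] {d n m : ℕ}
    {b : Fin n → Fin d → ℝ} {a : Fin (m * n) → Ω → Fin d → ℝ} {η : Fin (m * n) → Ω → ℝ}
    (ha : IsExploration b a η) (hη : ∀ t, Measurable (η t)) (t : Fin (m * n)) :
    history a η t ≤ mΩ := by
  induction t using WellFoundedLT.induction with
  | ind t ih =>
    refine iSup₂_le fun s hs => sup_le ?_ (hη s).comap_le
    exact ((ha.predictable s).comap_le).trans (ih s hs)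

theorem measurable_history_path {Ω : Type*} {d T : ℕ} (a : Fin T → Ω → Fin d → ℝ)
    (η : Fin T → Ω → ℝ) {s t : Fin T} (hst : s < t) : Measurable[history a η t] (a s) :=
  measurable_iff_comap_le.2 (le_sup_left.trans
    (le_iSup₂ (f := fun (s : Fin T) (_ : s < t) => (MeasurableSpace.comap (a s) inferInstance ⊔
      MeasurableSpace.comap (η s) inferInstance)) s hst))

theorem measurable_history_noise {Ω : Type*} {d T : ℕ} (a : Fin T → Ω → Fin d → ℝ)
    (η : Fin T → Ω → ℝ) {s t : Fin T} (hst : s < t) : Measurable[history a η t] (η s) :=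
  measurable_iff_comap_le.2 (le_sup_right.trans
    (le_iSup₂ (f := fun (s : Fin T) (_ : s < t) => (MeasurableSpace.comap (a s) inferInstance ⊔
      MeasurableSpace.comap (η s) inferInstance)) s hst))

/-! ### Exponential moments of predictably signed noise -/

/-- A sum of `k` terms is at most `k` times the largest, so exponential moments of single terms at
`±(k * α)` suffice, without independence. -/
theorem integrable_exp_sum {Ω ι : Type*} [MeasurableSpace Ω] {P : Measure Ω}
    [IsProbabilityMeasure P] (F : Finset ι) {c η : ι → Ω → ℝ} (hc : ∀ t, Measurable (c t))
    (hη : ∀ t, Measurable (η t)) (hc1 : ∀ t ω, |c t ω| ≤ 1)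
    (hint : ∀ t (α : ℝ), Integrable (fun ω => Real.exp (α * η t ω)) P) (α : ℝ) :
    Integrable (fun ω => Real.exp (α * ∑ t ∈ F, c t ω * η t ω)) P := by
  rcases F.eq_empty_or_nonempty with rfl | hF
  · simp
  set k : ℝ := (F.card : ℝ)
  refine Integrable.mono' (g := fun ω => ∑ t ∈ F,
    (Real.exp ((k * α) * η t ω) + Real.exp (-(k * α) * η t ω)))
    (integrable_finsetSum _ fun t _ => (hint t _).add (hint t _)) ?_ ?_
  · exact (Real.measurable_exp.comp ((Finset.measurable_sum F
      fun t _ => (hc t).mul (hη t)).const_mul α)).aestronglyMeasurable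
  · refine Filter.Eventually.of_forall fun ω => ?_
    rw [Real.norm_eq_abs, Real.abs_exp]
    obtain ⟨s, hs, hmax⟩ := F.exists_max_image (fun t => |α * η t ω|) hF
    have h1 : α * ∑ t ∈ F, c t ω * η t ω ≤ k * |α * η s ω| := by
      rw [Finset.mul_sum]
      refine (Finset.sum_le_card_nsmul F _ _ fun t ht => ?_).trans_eq (nsmul_eq_mul _ _)
      calc α * (c t ω * η t ω) ≤ |c t ω * (α * η t ω)| := by
            rw [mul_left_comm]; exact le_abs_self _
        _ ≤ 1 * |α * η t ω| := by
            rw [abs_mul]; exact mul_le_mul_of_nonneg_right (hc1 t ω) (abs_nonneg _)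
        _ ≤ |α * η s ω| := by rw [one_mul]; exact hmax t ht
    refine le_trans ?_ (Finset.single_le_sum (f := fun t =>
      Real.exp ((k * α) * η t ω) + Real.exp (-(k * α) * η t ω)) (fun t _ => by positivity) hs)
    refine (Real.exp_le_exp.2 h1).trans ?_
    rcases abs_cases (α * η s ω) with ⟨h, -⟩ | ⟨h, -⟩ <;> rw [h]
    · rw [← mul_assoc]; exact le_add_of_nonneg_right (Real.exp_pos _).le
    · rw [mul_neg, ← mul_assoc, ← neg_mul]; exact le_add_of_nonneg_left (Real.exp_pos _).le

theorem integral_mul_le_of_condExp_le {Ω : Type*} {m₀ m : MeasurableSpace Ω}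
    {P : Measure[m₀] Ω} [IsProbabilityMeasure P] (hm : m ≤ m₀) {f g : Ω → ℝ} {K : ℝ}
    (hf : StronglyMeasurable[m] f) (hf0 : 0 ≤ f) (hfi : Integrable f P) (hg : Integrable g P)
    (hfg : Integrable (f * g) P) (hK : ∀ᵐ ω ∂P, (P[g | m]) ω ≤ K) :
    ∫ ω, f ω * g ω ∂P ≤ K * ∫ ω, f ω ∂P := by
  have hpull := condExp_mul_of_stronglyMeasurable_left hf hfg hg
  calc ∫ ω, f ω * g ω ∂P = ∫ ω, (P[f * g | m]) ω ∂P := (integral_condExp hm).symm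
    _ ≤ ∫ ω, K * f ω ∂P := by
        refine integral_mono_ae integrable_condExp (hfi.const_mul K) ?_
        filter_upwards [hpull, hK] with ω h1 h2
        rw [h1, Pi.mul_apply, mul_comm]
        exact mul_le_mul_of_nonneg_right h2 (hf0 ω)
    _ = K * ∫ ω, f ω ∂P := integral_const_mul _ _

/-- One step of the exponential supermartingale, with a predictable sign `c`. -/
theorem integral_mul_exp_sign_le {Ω : Type*} {m₀ m : MeasurableSpace Ω}
    {P : Measure[m₀] Ω} [IsProbabilityMeasure P] (hm : m ≤ m₀) {f c η : Ω → ℝ} {K α : ℝ}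
    (hf : Measurable[m] f) (hf0 : 0 ≤ f) (hfi : Integrable f P)
    (hc : Measurable[m] c) (hc1 : ∀ ω, c ω = 1 ∨ c ω = -1)
    (hη : ∀ α : ℝ, Integrable (fun ω => Real.exp (α * η ω)) P)
    (hfη : Integrable (fun ω => f ω * Real.exp (α * (c ω * η ω))) P)
    (hK : ∀ᵐ ω ∂P, (P[fun ω => Real.exp (α * η ω) | m]) ω ≤ K)
    (hK' : ∀ᵐ ω ∂P, (P[fun ω => Real.exp (-α * η ω) | m]) ω ≤ K) :
    ∫ ω, f ω * Real.exp (α * (c ω * η ω)) ∂P ≤ K * ∫ ω, f ω ∂P := by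
  -- Splitting by the sign leaves only the deterministic exponents `α` and `-α`, where the
  -- conditional bounds apply.
  set A : Set Ω := c ⁻¹' {1}
  have hA : MeasurableSet[m] A := hc (measurableSet_singleton 1)
  have e1 : (A.indicator f * fun ω => Real.exp (α * η ω)) =
      A.indicator (fun ω => f ω * Real.exp (α * (c ω * η ω))) := by
    ext ω
    by_cases h : ω ∈ A
    · have : c ω = 1 := h
      simp [h, this]
    · simp [h]
  have e2 : (Aᶜ.indicator f * fun ω => Real.exp (-α * η ω)) =
      Aᶜ.indicator (fun ω => f ω * Real.exp (α * (c ω * η ω))) := by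
    ext ω
    by_cases h : ω ∈ A
    · simp [h]
    · have : c ω = -1 := (hc1 ω).resolve_left h
      simp [h, this]
  have h1 := integral_mul_le_of_condExp_le hm (hf.indicator hA).stronglyMeasurable
    (fun ω => Set.indicator_nonneg (fun ω _ => hf0 ω) ω) (hfi.indicator (hm _ hA)) (hη α)
    (by rw [e1]; exact hfη.indicator (hm _ hA)) hK
  have h2 := integral_mul_le_of_condExp_le hm (hf.indicator hA.compl).stronglyMeasurable
    (fun ω => Set.indicator_nonneg (fun ω _ => hf0 ω) ω) (hfi.indicator (hm _ hA.compl)) (hη (-α))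
    (by rw [e2]; exact hfη.indicator (hm _ hA.compl)) hK'
  have e1' : ∀ ω, A.indicator f ω * Real.exp (α * η ω) =
      A.indicator (fun ω => f ω * Real.exp (α * (c ω * η ω))) ω := fun ω => congrFun e1 ω
  have e2' : ∀ ω, Aᶜ.indicator f ω * Real.exp (-α * η ω) =
      Aᶜ.indicator (fun ω => f ω * Real.exp (α * (c ω * η ω))) ω := fun ω => congrFun e2 ω
  simp only [e1', integral_indicator (hm _ hA)] at h1
  simp only [e2', integral_indicator (hm _ hA.compl)] at h2
  rw [← integral_add_compl (hm _ hA) hfη, ← integral_add_compl (hm _ hA) hfi, mul_add]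
  exact add_le_add h1 h2

theorem IsCondSubGaussian.mgf_signed_sum_le {Ω : Type*} [mΩ : MeasurableSpace Ω] {P : Measure Ω}
    [IsProbabilityMeasure P] {d T : ℕ} {R : ℝ} {a : Fin T → Ω → Fin d → ℝ} {η : Fin T → Ω → ℝ}
    (hη : IsCondSubGaussian P R a η) (hle : ∀ t, history a η t ≤ mΩ)
    (ha : ∀ t, Measurable[history a η t] (a t)) {s : (Fin d → ℝ) → ℝ} (hs : Measurable s)
    (hs1 : ∀ t ω, s (a t ω) = 1 ∨ s (a t ω) = -1) (α : ℝ) :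
    ProbabilityTheory.mgf (fun ω => ∑ t, s (a t ω) * η t ω) P α ≤
      Real.exp (T * (α ^ 2 * R ^ 2 / 2)) := by
  have hc : ∀ t, Measurable (fun ω => s (a t ω)) := fun t => hs.comp ((ha t).mono (hle t) le_rfl)
  have hint := fun F : Finset (Fin T) => integrable_exp_sum (P := P) F hc hη.measurable
    (fun t ω => by rcases hs1 t ω with h | h <;> simp [h]) hη.integrable_exp α
  have key : ∀ k ≤ T, ∫ ω, Real.exp (α * ∑ t : Fin T with t.val < k, s (a t ω) * η t ω) ∂P ≤
      Real.exp (k * (α ^ 2 * R ^ 2 / 2)) := by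
    intro k
    induction k with
    | zero => simp
    | succ k ih =>
      intro hk
      set u : Fin T := ⟨k, hk⟩
      have hF : (Finset.univ.filter fun t : Fin T => t.val < k + 1) =
          insert u (Finset.univ.filter fun t : Fin T => t.val < k) := by
        ext t
        simp only [Finset.mem_filter, Finset.mem_univ, true_and, Finset.mem_insert, Fin.ext_iff, u]
        omega
      have hsplit : ∀ ω, Real.exp (α * ∑ t : Fin T with t.val < k + 1, s (a t ω) * η t ω) =
          Real.exp (α * ∑ t : Fin T with t.val < k, s (a t ω) * η t ω) *
            Real.exp (α * (s (a u ω) * η u ω)) := by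
        intro ω
        rw [hF, Finset.sum_insert (by simp [u]), ← Real.exp_add]
        ring_nf
      have hmeas : Measurable[history a η u]
          (fun ω => Real.exp (α * ∑ t : Fin T with t.val < k, s (a t ω) * η t ω)) := by
        refine Real.measurable_exp.comp (Measurable.const_mul
          (Finset.measurable_sum _ fun t ht => ?_) α)
        have htu : t < u := (Finset.mem_filter.1 ht).2
        exact (hs.comp (measurable_history_path a η htu)).mul (measurable_history_noise a η htu)
      have hi := hint (Finset.univ.filter fun t : Fin T => t.val < k + 1)
      simp only [hsplit] at hi ⊢
      have hK' := hη.condExp_exp_le u (-α)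
      rw [neg_sq] at hK'
      refine (integral_mul_exp_sign_le (hle u) hmeas (fun ω => (Real.exp_pos _).le) (hint _)
        (hs.comp (ha u)) (hs1 u) (hη.integrable_exp u) hi (hη.condExp_exp_le u α) hK').trans ?_
      refine (mul_le_mul_of_nonneg_left (ih (Nat.le_of_succ_le hk)) (Real.exp_pos _).le).trans_eq ?_
      rw [← Real.exp_add]
      push_cast
      ring_nf
  simpa [ProbabilityTheory.mgf] using key T le_rfl

theorem IsCondSubGaussian.measure_signed_sum_ge_le {Ω : Type*} [mΩ : MeasurableSpace Ω]
    {P : Measure Ω} [IsProbabilityMeasure P] {d T : ℕ} {R : ℝ} {a : Fin T → Ω → Fin d → ℝ}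
    {η : Fin T → Ω → ℝ} (hη : IsCondSubGaussian P R a η) (hle : ∀ t, history a η t ≤ mΩ)
    (ha : ∀ t, Measurable[history a η t] (a t)) {s : (Fin d → ℝ) → ℝ} (hs : Measurable s)
    (hs1 : ∀ t ω, s (a t ω) = 1 ∨ s (a t ω) = -1) (hR : 0 < R) (hT : 0 < T) {u : ℝ} (hu : 0 ≤ u) :
    P.real {ω | u ≤ ∑ t, s (a t ω) * η t ω} ≤ Real.exp (-(u ^ 2 / (2 * R ^ 2 * T))) := by
  have hT' : (0 : ℝ) < T := Nat.cast_pos.2 hT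
  -- The minimiser of the Chernoff exponent `-α * u + T * α ^ 2 * R ^ 2 / 2`.
  set α : ℝ := u / (R ^ 2 * T)
  have hint := integrable_exp_sum (P := P) Finset.univ
    (fun t => hs.comp ((ha t).mono (hle t) le_rfl)) hη.measurable
    (fun t ω => by rcases hs1 t ω with h | h <;> simp [h]) hη.integrable_exp α
  refine (ProbabilityTheory.measure_ge_le_exp_mul_mgf u (by positivity : 0 ≤ α) hint).trans ?_
  refine (mul_le_mul_of_nonneg_left (hη.mgf_signed_sum_le hle ha hs hs1 α)
    (Real.exp_pos _).le).trans_eq ?_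
  rw [← Real.exp_add]
  congr 1
  simp only [α]
  field_simp
  ring

/-- The function on vectors that is `ε i` at `b i`, for injective `b`, and `0` off the range of `b`. -/
noncomputable def signAt {d n : ℕ} (b : Fin n → Fin d → ℝ) (ε : Fin n → Bool)
    (x : Fin d → ℝ) : ℝ :=
  ∑ i, if x = b i then (if ε i then 1 else -1) else 0

theorem signAt_apply {d n : ℕ} {b : Fin n → Fin d → ℝ} (hb : Function.Injective b)
    (ε : Fin n → Bool) (i : Fin n) : signAt b ε (b i) = if ε i then 1 else -1 := by
  simp [signAt, hb.eq_iff]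

theorem measurable_signAt {d n : ℕ} (b : Fin n → Fin d → ℝ) (ε : Fin n → Bool) :
    Measurable (signAt b ε) :=
  Finset.measurable_sum _ fun i _ =>
    Measurable.ite (measurableSet_singleton (b i)) measurable_const measurable_const

/-- The optimal signs depend on the realised noise, which is why a union bound over all sign
patterns is needed. -/
theorem exists_signs_sum_abs_eq {n T : ℕ} (idx : Fin T → Fin n) (z : Fin T → ℝ) :
    ∃ ε : Fin n → Bool, ∑ i, |∑ t with idx t = i, z t| =
      ∑ t, (if ε (idx t) then 1 else -1) * z t := by
  refine ⟨fun i => decide (0 ≤ ∑ t with idx t = i, z t), ?_⟩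
  rw [← Finset.sum_fiberwise Finset.univ idx]
  refine Finset.sum_congr rfl fun i _ => ?_
  have : ∑ t with idx t = i, (if decide (0 ≤ ∑ t' with idx t' = idx t, z t') then (1 : ℝ) else -1) *
      z t = (if decide (0 ≤ ∑ t' with idx t' = i, z t') then (1 : ℝ) else -1) *
        ∑ t with idx t = i, z t := by
    rw [Finset.mul_sum]
    exact Finset.sum_congr rfl fun t ht => by rw [(Finset.mem_filter.1 ht).2]
  rw [this]
  by_cases h : 0 ≤ ∑ t with idx t = i, z t
  · simp [h, abs_of_nonneg h]
  · simp [h, abs_of_neg (not_le.1 h)]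

/-! ### Error of the estimator and the union bound -/

theorem abs_dotProduct_olsEstimator_sub_le {Ω : Type*} {d n T : ℕ} {m S : ℝ} (hm : 0 < m)
    {W : Set (Fin d → ℝ)} {b : Fin n → Fin d → ℝ} (hb : IsApproxBarycentricSpanner W S b)
    (μ : Fin d → ℝ) (a : Fin T → Ω → Fin d → ℝ)
    (η : Fin T → Ω → ℝ) (ω : Ω) (idx : Fin T → Fin n) (hidx : ∀ t, a t ω = b (idx t))
    (hcount : ∀ f : Fin n → Fin d → ℝ, ∑ t, f (idx t) = m • ∑ i, f i) {x : Fin d → ℝ}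
    (hx : x ∈ W) :
    m * |x ⬝ᵥ μ - x ⬝ᵥ olsEstimator μ a η ω| ≤ S * ∑ i, |∑ t with idx t = i, η t ω| := by
  obtain ⟨ν, hν, hxν⟩ := hb.exists_coeff x hx
  rw [abs_sub_comm, ← dotProduct_sub, ← abs_of_pos hm, ← abs_mul]
  have : m * (x ⬝ᵥ (olsEstimator μ a η ω - μ)) = ∑ i, ν i * ∑ t with idx t = i, η t ω := by
    simp only [← mul_dotProduct_olsEstimator_sub hb.linearIndependent μ a η ω idx hidx hcount]
    rw [hxν, sum_dotProduct, Finset.mul_sum]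
    refine Finset.sum_congr rfl fun i _ => ?_
    rw [smul_dotProduct, smul_eq_mul, mul_left_comm]
  rw [this, Finset.mul_sum]
  refine (Finset.abs_sum_le_sum_abs _ _).trans (Finset.sum_le_sum fun i _ => ?_)
  rw [abs_mul]
  exact mul_le_mul_of_nonneg_right (hν i) (abs_nonneg _)

theorem IsApproxBarycentricSpanner.pos {d n : ℕ} {W : Set (Fin d → ℝ)} {S : ℝ}
    {b : Fin n → Fin d → ℝ} (hb : IsApproxBarycentricSpanner W S b) {x : Fin d → ℝ}
    (hx : x ∈ W) (hx0 : x ≠ 0) : 0 < S ∧ 0 < n := by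
  obtain ⟨ν, hν, rfl⟩ := hb.exists_coeff x hx
  obtain ⟨i, -, hi⟩ := Finset.exists_ne_zero_of_sum_ne_zero hx0
  exact ⟨(abs_pos.2 fun h => hi (by rw [h, zero_smul])).trans_le (hν i), i.pos⟩

/-- There is ample slack: `2 ≤ 6 ^ 16` absorbs the number of sign patterns, and `δ ^ 16 ≤ δ`. -/
theorem two_pow_mul_exp_le (n : ℕ) {δ : ℝ} (hδ₀ : 0 < δ) (hδ₁ : δ ≤ 1) :
    2 ^ n * Real.exp (-(16 * Real.log 6 * n + 16 * Real.log δ⁻¹)) ≤ δ := by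
  have h2 : Real.exp (Real.log 2) = 2 := Real.exp_log two_pos
  have hlog : Real.log 2 ≤ Real.log 6 := Real.log_le_log two_pos (by norm_num)
  have h6 : 0 ≤ Real.log 6 := Real.log_nonneg (by norm_num)
  have hδ : Real.log δ ≤ 0 := Real.log_nonpos hδ₀.le hδ₁
  calc 2 ^ n * Real.exp (-(16 * Real.log 6 * n + 16 * Real.log δ⁻¹))
      = Real.exp (n * Real.log 2 - (16 * Real.log 6 * n + 16 * Real.log δ⁻¹)) := by
        rw [sub_eq_add_neg, Real.exp_add, Real.exp_nat_mul, h2]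
    _ ≤ Real.exp (Real.log δ) := by
        rw [Real.log_inv]
        refine Real.exp_le_exp.2 ?_
        have hn : (0 : ℝ) ≤ n := n.cast_nonneg
        nlinarith [mul_le_mul_of_nonneg_left hlog hn, mul_nonneg hn h6]
    _ = δ := Real.exp_log hδ₀

theorem theorem4 {V : Type*} {d : ℕ} (N : Network V d) (d₀ : ℕ) (hd₀ : N.rank = d₀)
    (S : ℝ) (b : Fin d₀ → Fin d → ℝ) (hb : IsApproxBarycentricSpanner N.pathSet S b)
    (μ : Fin d → ℝ) (R : ℝ) (hR : 0 < R) (m : ℕ) (hm : 0 < m)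
    {Ω : Type*} [MeasurableSpace Ω] (P : Measure Ω) [IsProbabilityMeasure P]
    (a : Fin (m * d₀) → Ω → Fin d → ℝ) (η : Fin (m * d₀) → Ω → ℝ)
    (hη : IsCondSubGaussian P R a η) (ha : IsExploration b a η)
    (δ : ℝ) (hδ₀ : 0 < δ) (hδ₁ : δ ≤ 1) :
    P.real {ω | ∃ x ∈ N.pathSet,
        S * R * √((32 * Real.log 6 * (d₀ : ℝ) ^ 2 + 32 * (d₀ : ℝ) * Real.log δ⁻¹) / (m : ℝ)) ≤
          |x ⬝ᵥ μ - x ⬝ᵥ olsEstimator μ a η ω|} ≤ δ := by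
  -- Without paths the event is empty; otherwise a nonzero path forces `S` and `d₀` to be positive.
  rcases N.pathSet.eq_empty_or_nonempty with hW | ⟨x₀, hx₀⟩
  · simp [hW, hδ₀.le]
  obtain ⟨hS, hn⟩ := hb.pos hx₀ (N.ne_zero_of_mem_pathSet hx₀)
  have hm' : (0 : ℝ) < m := Nat.cast_pos.2 hm
  have hn' : (0 : ℝ) < d₀ := Nat.cast_pos.2 hn
  have hinj := hb.linearIndependent.injective
  set q : ℝ := (32 * Real.log 6 * (d₀ : ℝ) ^ 2 + 32 * (d₀ : ℝ) * Real.log δ⁻¹) / (m : ℝ) with hq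
  have hq0 : 0 ≤ q := by
    have h6 : 0 ≤ Real.log 6 := Real.log_nonneg (by norm_num)
    have hδ : 0 ≤ Real.log δ⁻¹ := Real.log_nonneg ((one_le_inv₀ hδ₀).2 hδ₁)
    positivity
  set u : ℝ := m * (R * √q) with hu
  have hsub : {ω | ∃ x ∈ N.pathSet, S * R * √q ≤ |x ⬝ᵥ μ - x ⬝ᵥ olsEstimator μ a η ω|} ⊆
      ⋃ ε : Fin d₀ → Bool, {ω | u ≤ ∑ t, signAt b ε (a t ω) * η t ω} := by
    rintro ω ⟨x, hx, hxω⟩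
    obtain ⟨idx, hidx, hcount⟩ := ha.exists_index ω
    obtain ⟨ε, hε⟩ := exists_signs_sum_abs_eq idx (fun t => η t ω)
    have h := abs_dotProduct_olsEstimator_sub_le hm' hb μ a η ω idx hidx hcount hx
    refine Set.mem_iUnion.2 ⟨ε, ?_⟩
    simp only [Set.mem_ofPred_eq, hidx, signAt_apply hinj]
    rw [← hε]
    refine le_of_mul_le_mul_left ?_ hS
    calc S * u = m * (S * R * √q) := by rw [hu]; ring
      _ ≤ _ := (mul_le_mul_of_nonneg_left hxω hm'.le).trans h
  have htail : ∀ ε : Fin d₀ → Bool, P.real {ω | u ≤ ∑ t, signAt b ε (a t ω) * η t ω} ≤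
      Real.exp (-(16 * Real.log 6 * d₀ + 16 * Real.log δ⁻¹)) := by
    intro ε
    refine (hη.measure_signed_sum_ge_le (ha.history_le hη.measurable) ha.predictable
      (measurable_signAt b ε) (fun t ω => ?_) hR (Nat.mul_pos hm hn)
      (by positivity : 0 ≤ u)).trans_eq ?_
    · obtain ⟨idx, hidx, -⟩ := ha.exists_index ω
      rw [hidx, signAt_apply hinj]
      split <;> simp
    -- Here `u ^ 2 / (2 * R ^ 2 * (m * d₀)) = m * q / (2 * d₀)`, which turns the constant `32` into
    -- `16`.
    · congr 2
      rw [hu, mul_pow, mul_pow, Real.sq_sqrt hq0, hq]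
      push_cast
      field_simp
      ring
  calc P.real _ ≤ P.real (⋃ ε : Fin d₀ → Bool, {ω | u ≤ ∑ t, signAt b ε (a t ω) * η t ω}) :=
        measureReal_mono hsub
    _ ≤ ∑ ε : Fin d₀ → Bool, P.real {ω | u ≤ ∑ t, signAt b ε (a t ω) * η t ω} :=
        measureReal_iUnion_fintype_le _
    _ ≤ ∑ _ε : Fin d₀ → Bool, Real.exp (-(16 * Real.log 6 * d₀ + 16 * Real.log δ⁻¹)) :=
        Finset.sum_le_sum fun ε _ => htail ε
    _ = 2 ^ d₀ * Real.exp (-(16 * Real.log 6 * d₀ + 16 * Real.log δ⁻¹)) := by simp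
    _ ≤ δ := two_pow_mul_exp_le d₀ hδ₀ hδ₁
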